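/- Let $\mathbf k$ be a field with minimal (prime) subfield $\mathbf F$, let $G$ be an abelian group, and let $x_1,\dots,x_n$ be quantum variables: to each $x_i$ are attached an element $g_{x_i}\in G$ and a character $\chi^{x_i}:G\to\mathbf k^*$. Put $p_{ij}=\chi^{x_i}(g_{x_j})$. A subset of at least two of the variables, with index set $Y\subseteq\{1,\dots,n\}$, is conforming if $\prod_{i\ne j\in Y}p_{ij}=1$. Let $\mathcal P_n$ be the group algebra over $\mathbf F$ of the free abelian group $\mathcal F_n$ on symbols $P_{ij}$, $1\le i\ne j\le n$, and let $\varphi:\mathcal P_n\to\mathbf k$ be the $\mathbf F$-algebra homomorphism with $\varphi(P_{ij})=p_{ij}$. The symmetric group $S_n$ acts on $\mathcal P_n$ by $P_{ij}^{\pi}=P_{\pi(i)\pi(j)}$, permutations being multiplied from left to right. For $A\in\mathcal F_n$ let $\overline A$ be obtained from $A$ by replacing every $P_{ij}$ with $P_{ji}$, and put $\{A\}=A-\overline A^{\,-1}$. For $Y\subseteq\{1,\dots,n\}$ let $W(Y)$ be the set of all $\{W\}$, where $W$ is a semigroup word of length $\binom{|Y|}{2}$ in the letters $P_{ij}$, $i\ne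 j\in Y$, that contains no letter twice and no two conjugated letters $P_{ij},P_{ji}$. For $3\le m\le n$ let $\Sigma_m$ be the multiplicative set generated by all $W(Y)$ with $Y\subseteq\{1,\dots,m-1\}$, $|Y|\ge2$. Let $S_{m-1}^1$ be the group of the permutations in $S_n$ that fix $1$ and $m,m+1,\dots,n$; it leaves $\Sigma_m$ invariant. Let $\mathcal P_n\Sigma_m^{-1}*S_{m-1}^1$ be the skew group ring, in which $A\pi=\pi A^{\pi}$. Define in it $$V_{(m)}=\sum_{l=2}^{m-1}[2;l]\;\{P_{12}P_{32}P_{42}\cdots P_{l2}\},$$ where $[2;l]$ is the cycle $(2,3,\dots,l)$. Suppose that $x_n$ belongs to every conforming subset of $\{x_1,\dots,x_n\}$. Then for every $m$ with $3\le m\le n$ the set $\Sigma_m$ does not intersect $\ker\varphi$, and $V_{(m)}$ is invertible in $\mathcal P_n\Sigma_m^{-1}*S_{m-1}^1$. -/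

import Mathlib

/-!
Labels: the index `i : Fin n` stands for the label `i + 1` of the list `1, …, n`.
-/

noncomputable section

namespace QuantumLie

/-- A quantum variable: an element of the abelian group `G` and a character of `G`. -/
structure QuantumVariable (G k : Type*) [CommGroup G] [Field k] where
  g : G
  χ : G →* kˣ

/-- The quantization parameters `p i j = χ^{x_i} (g_{x_j})`. -/
def quantParam {G k : Type*} [CommGroup G] [Field k] {n : ℕ}
    (x : Fin n → QuantumVariable G k) (i j : Fin n) : kˣ :=
  (x i).χ (x j).g

/-- The subset `{x_i | i ∈ Y}` is conforming: the product of all `p i j`, `i ≠ j` in `Y`,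
equals `1`. -/
def IsConforming {G k : Type*} [CommGroup G] [Field k] {n : ℕ}
    (x : Fin n → QuantumVariable G k) (Y : Finset (Fin n)) : Prop :=
  ∏ a ∈ Y.offDiag, quantParam x a.1 a.2 = 1

/-- The letters `P_{ij}`, `i ≠ j`. -/
abbrev Letter (n : ℕ) : Type := {a : Fin n × Fin n // a.1 ≠ a.2}

/-- The conjugated letter: `P_{ij} ↦ P_{ji}`. -/
def Letter.conj (n : ℕ) : Letter n ≃ Letter n where
  toFun a := ⟨(a.1.2, a.1.1), a.2.symm⟩
  invFun a := ⟨(a.1.2, a.1.1), a.2.symm⟩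
  left_inv _ := rfl
  right_inv _ := rfl

/-- The action of a permutation on letters: `P_{ij} ↦ P_{π(i) π(j)}`. -/
def Letter.perm {n : ℕ} (π : Equiv.Perm (Fin n)) : Letter n ≃ Letter n where
  toFun a := ⟨(π a.1.1, π a.1.2), fun h => a.2 (π.injective h)⟩
  invFun a := ⟨(π.symm a.1.1, π.symm a.1.2), fun h => a.2 (π.symm.injective h)⟩
  left_inv a := by ext <;> simp
  right_inv a := by ext <;> simp

/-- The free abelian group on the letters `P_{ij}`, written additively. -/
abbrev Word (n : ℕ) : Type := Letter n →₀ ℤ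

/-- The group algebra over `F` of the free abelian group on the letters `P_{ij}`. -/
abbrev PRing (F : Type*) [Field F] (n : ℕ) : Type _ := AddMonoidAlgebra F (Word n)

/-- A word as an element of the group algebra. -/
def mono (F : Type*) [Field F] {n : ℕ} (A : Word n) : PRing F n := AddMonoidAlgebra.single A 1

/-- `{A} = A - (conjugate of A)⁻¹` -/
def brace (F : Type*) [Field F] {n : ℕ} (A : Word n) : PRing F n :=
  mono F A - mono F (-(Finsupp.domCongr (Letter.conj n) A))

/-- The homomorphism `φ : P_{ij} ↦ p_{ij}`, over the minimal subfield of `k`. -/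
def phi {G k : Type*} [CommGroup G] [Field k] {n : ℕ} (x : Fin n → QuantumVariable G k) :
    PRing (⊥ : Subfield k) n →ₐ[(⊥ : Subfield k)] k :=
  AddMonoidAlgebra.lift (⊥ : Subfield k) k (Word n)
    { toFun := fun A => ((∏ a : Letter n, quantParam x a.1.1 a.1.2 ^ (A.toAdd a) : kˣ) : k)
      map_one' := by simp
      map_mul' := fun A B => by simp [zpow_add, Finset.prod_mul_distrib] }

/-- The action of a permutation on the group algebra: `P_{ij} ↦ P_{π(i) π(j)}`. -/
def permAut (F : Type*) [Field F] {n : ℕ} (π : Equiv.Perm (Fin n)) : PRing F n ≃+* PRing F n :=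
  (AddMonoidAlgebra.domCongr F F (Finsupp.domCongr (M := ℤ) (Letter.perm π))).toRingEquiv

/-- `W` is (the set of letters of) a semigroup word in the letters `P_{ij}`, `i, j ∈ Y`, of length
`|Y| choose 2`, with neither double nor conjugated letters. -/
def IsHalfWord {n : ℕ} (Y : Finset (Fin n)) (W : Finset (Letter n)) : Prop :=
  (∀ a ∈ W, a.1.1 ∈ Y ∧ a.1.2 ∈ Y) ∧ (∀ a ∈ W, Letter.conj n a ∉ W) ∧ W.card = Y.card.choose 2

/-- The word that is the product of the letters in `W`. -/
def wordOf {n : ℕ} (W : Finset (Letter n)) : Word n := ∑ a ∈ W, Finsupp.single a 1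

/-- The set `W(Y)` of the elements `{W}`. -/
def halfWords (F : Type*) [Field F] {n : ℕ} (Y : Finset (Fin n)) : Set (PRing F n) :=
  {f | ∃ W : Finset (Letter n), IsHalfWord Y W ∧ f = brace F (wordOf W)}

/-- The generators of `Σ_m`: the elements of `W(Y)`, where `Y` has at least two elements and
contains none of the labels `m, …, n`. -/
def sigmaGens (F : Type*) [Field F] (n m : ℕ) : Set (PRing F n) :=
  {f | ∃ Y : Finset (Fin n), 2 ≤ Y.card ∧ (∀ i ∈ Y, (i : ℕ) + 1 < m) ∧ f ∈ halfWords F Y}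

/-- The multiplicative set `Σ_m`. -/
def Sig (F : Type*) [Field F] (n m : ℕ) : Submonoid (PRing F n) :=
  Submonoid.closure (sigmaGens F n m)

/-- The group `S_{m-1}^1` of the permutations that fix the label `1` and the labels `m, …, n`. -/
def S1 (n m : ℕ) : Subgroup (Equiv.Perm (Fin n)) where
  carrier := {π | ∀ i : Fin n, (i : ℕ) + 1 = 1 ∨ m ≤ (i : ℕ) + 1 → π i = i}
  mul_mem' := fun {a b} ha hb i hi => by rw [Equiv.Perm.mul_apply, hb i hi, ha i hi]
  one_mem' := fun i _ => rfl
  inv_mem' := fun {a} ha i hi => by rw [Equiv.Perm.inv_eq_iff_eq, ha i hi]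

/-! ### The action of `S_{m-1}^1` on the localization -/

theorem permAut_mono (F : Type*) [Field F] {n : ℕ} (π : Equiv.Perm (Fin n)) (A : Word n) :
    permAut F π (mono F A) = mono F (Finsupp.domCongr (Letter.perm π) A) := by
  simp [permAut, mono, AddMonoidAlgebra.domCongr]

theorem permAut_brace (F : Type*) [Field F] {n : ℕ} (π : Equiv.Perm (Fin n)) (A : Word n) :
    permAut F π (brace F A) = brace F (Finsupp.domCongr (Letter.perm π) A) := by
  have h : ∀ A : Word n, Finsupp.domCongr (Letter.perm π) (Finsupp.domCongr (Letter.conj n) A) =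
      Finsupp.domCongr (Letter.conj n) (Finsupp.domCongr (Letter.perm π) A) := by
    intro A
    ext a
    rfl
  simp only [brace, map_sub, permAut_mono, map_neg, h]

theorem permAut_one (F : Type*) [Field F] (n : ℕ) (f : PRing F n) :
    permAut F (1 : Equiv.Perm (Fin n)) f = f := by
  have h : ∀ A : Word n, Finsupp.domCongr (M := ℤ) (Letter.perm (1 : Equiv.Perm (Fin n))) A = A := by
    intro A
    ext a
    rfl
  induction f using AddMonoidAlgebra.induction_linear with
  | zero => simp
  | add f g hf hg => rw [map_add, hf, hg]
  | single A r => simp [permAut, h]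

theorem permAut_mul (F : Type*) [Field F] {n : ℕ} (π σ : Equiv.Perm (Fin n)) (f : PRing F n) :
    permAut F (π * σ) f = permAut F π (permAut F σ f) := by
  have h : ∀ A : Word n, Finsupp.domCongr (M := ℤ) (Letter.perm (π * σ)) A =
      Finsupp.domCongr (Letter.perm π) (Finsupp.domCongr (Letter.perm σ) A) := by
    intro A
    ext a
    rfl
  induction f using AddMonoidAlgebra.induction_linear with
  | zero => simp
  | add f g hf hg => simp only [map_add, hf, hg]
  | single A r => simp [permAut, h]

theorem permAut_mem_sig (F : Type*) [Field F] {n m : ℕ} (π : S1 n m) {f : PRing F n}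
    (hf : f ∈ Sig F n m) : permAut F (π : Equiv.Perm (Fin n)) f ∈ Sig F n m := by
  suffices h : Sig F n m ≤ (Sig F n m).comap (permAut F (π : Equiv.Perm (Fin n))).toMonoidHom from
    h hf
  refine Submonoid.closure_le.2 ?_
  rintro f ⟨Y, hY, hYm, W, ⟨hW1, hW2, hW3⟩, rfl⟩
  refine Submonoid.subset_closure ⟨Y.map (π : Equiv.Perm (Fin n)).toEmbedding, ?_, ?_,
    W.map (Letter.perm (π : Equiv.Perm (Fin n))).toEmbedding, ⟨?_, ?_, ?_⟩, ?_⟩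
  · simpa using hY
  · intro i hi
    obtain ⟨j, hj, rfl⟩ := Finset.mem_map.1 hi
    by_contra hlt
    have h1 := π.2 ((π : Equiv.Perm (Fin n)) j) (Or.inr (not_lt.1 hlt))
    have h2 := (π : Equiv.Perm (Fin n)).injective h1
    have h3 := hYm j hj
    simp only [Equiv.coe_toEmbedding, h2] at hlt
    exact hlt h3
  · intro a ha
    obtain ⟨b, hb, rfl⟩ := Finset.mem_map.1 ha
    exact ⟨Finset.mem_map_of_mem _ (hW1 b hb).1, Finset.mem_map_of_mem _ (hW1 b hb).2⟩
  · intro a ha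
    obtain ⟨b, hb, rfl⟩ := Finset.mem_map.1 ha
    intro hc
    obtain ⟨c, hc, hcb⟩ := Finset.mem_map.1 hc
    have : c = Letter.conj n b := (Letter.perm (π : Equiv.Perm (Fin n))).injective hcb
    exact hW2 b hb (this ▸ hc)
  · simpa using hW3
  · change permAut F _ _ = _
    rw [permAut_brace]
    congr 1
    simp [wordOf, map_sum]

/-- The localization `P_n Σ_m⁻¹`. -/
abbrev PLoc (F : Type*) [Field F] (n m : ℕ) : Type _ := Localization (Sig F n m)

/-- The endomorphism of `P_n Σ_m⁻¹` that extends the action of `π` on `P_n`. -/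
def locHom (F : Type*) [Field F] {n m : ℕ} (π : S1 n m) : PLoc F n m →+* PLoc F n m :=
  IsLocalization.map (M := Sig F n m) (T := Sig F n m) (PLoc F n m)
    ((permAut F (π : Equiv.Perm (Fin n)) : PRing F n ≃+* PRing F n) : PRing F n →+* PRing F n)
    (fun _ hf => permAut_mem_sig F π hf)

theorem locHom_algebraMap (F : Type*) [Field F] {n m : ℕ} (π : S1 n m) (f : PRing F n) :
    locHom F π (algebraMap (PRing F n) (PLoc F n m) f) =
      algebraMap (PRing F n) (PLoc F n m) (permAut F (π : Equiv.Perm (Fin n)) f) :=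
  IsLocalization.map_eq _ _

theorem locHom_one (F : Type*) [Field F] (n m : ℕ) :
    locHom F (1 : S1 n m) = RingHom.id (PLoc F n m) := by
  refine IsLocalization.ringHom_ext (Sig F n m) (RingHom.ext fun f => ?_)
  simp [locHom_algebraMap, permAut_one]

theorem locHom_mul (F : Type*) [Field F] {n m : ℕ} (π σ : S1 n m) :
    locHom F (π * σ) = (locHom F π).comp (locHom F σ) := by
  refine IsLocalization.ringHom_ext (Sig F n m) (RingHom.ext fun f => ?_)
  simp [locHom_algebraMap, permAut_mul]

/-- The action `P_{ij} ↦ P_{π(i) π(j)}` of `S_{m-1}^1` on `P_n Σ_m⁻¹`. -/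
instance (F : Type*) [Field F] (n m : ℕ) : MulSemiringAction (S1 n m) (PLoc F n m) where
  smul π a := locHom F π a
  one_smul a := congrArg (fun h : PLoc F n m →+* PLoc F n m => h a) (locHom_one F n m)
  mul_smul π σ a := congrArg (fun h : PLoc F n m →+* PLoc F n m => h a) (locHom_mul F π σ)
  smul_zero π := map_zero (locHom F π)
  smul_add π := map_add (locHom F π)
  smul_one π := map_one (locHom F π)
  smul_mul π := map_mul (locHom F π)

theorem smul_algebraMap_eq (F : Type*) [Field F] {n m : ℕ} (π : S1 n m) (f : PRing F n) :
    π • algebraMap (PRing F n) (PLoc F n m) f =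
      algebraMap (PRing F n) (PLoc F n m) (permAut F (π : Equiv.Perm (Fin n)) f) :=
  locHom_algebraMap F π f

/-! ### The skew group ring -/

/-- The skew group ring `P_n Σ_m⁻¹ * S_{m-1}^1`, with the commutation rule `A π = π A^π`, where
`P_{ij}^π = P_{π(i) π(j)}` and permutations are multiplied from left to right. Mathlib's
`SkewMonoidAlgebra` has the rule `π A = A^π π` and permutations multiplied from right to left, so
the ring meant here is its opposite; see `coef_mul_grp` and `grp_mul_grp`. -/
abbrev SkewRing (F : Type*) [Field F] (n m : ℕ) : Type _ :=
  (SkewMonoidAlgebra (PLoc F n m) (S1 n m))ᵐᵒᵖ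

/-- A permutation as an element of the skew group ring. -/
def grp (F : Type*) [Field F] {n m : ℕ} (π : S1 n m) : SkewRing F n m :=
  MulOpposite.op (SkewMonoidAlgebra.single π 1)

/-- A coefficient as an element of the skew group ring. -/
def coef (F : Type*) [Field F] {n m : ℕ} (a : PLoc F n m) : SkewRing F n m :=
  MulOpposite.op (SkewMonoidAlgebra.single 1 a)

theorem coef_mul_grp (F : Type*) [Field F] {n m : ℕ} (a : PLoc F n m) (π : S1 n m) :
    coef F a * grp F π = grp F π * coef F (π • a) := by
  simp only [coef, grp, ← MulOpposite.op_mul, SkewMonoidAlgebra.single_mul_single, one_smul,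
    mul_one, one_mul]

theorem grp_mul_grp (F : Type*) [Field F] {n m : ℕ} (π σ : S1 n m) :
    grp F π * grp F σ = grp F (σ * π) := by
  simp only [grp, ← MulOpposite.op_mul, SkewMonoidAlgebra.single_mul_single, smul_one, mul_one]

/-! ### The elements `V_(m)` -/

/-- The cycle `[2; l] = (2, 3, …, l)`, for a label `2 ≤ l < m`, as an element of `S_{m-1}^1`. -/
def cyc {n m : ℕ} (hmn : m ≤ n) (l : ℕ) (hl : 2 ≤ l ∧ l < m) : S1 n m :=
  ⟨Fin.cycleIcc ⟨1, by omega⟩ ⟨l - 1, by omega⟩, by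
    rintro i (hi | hi)
    · exact Fin.cycleIcc_of_lt (Fin.lt_def.2 (by simp only; omega))
    · exact Fin.cycleIcc_of_gt (Fin.lt_def.2 (by simp only; omega))⟩

/-- The word `P_{12} P_{32} P_{42} ⋯ P_{l2}`: the product of all `P_{i2}` with `i ≤ l`, `i ≠ 2`. -/
def tWord (n l : ℕ) : Word n :=
  wordOf (Finset.univ.filter fun a : Letter n => (a.1.1 : ℕ) + 1 ≤ l ∧ (a.1.2 : ℕ) + 1 = 2)

/-- `V_(m) = ∑_{l=2}^{m-1} [2; l] T_{[2; l]}`, where `T_{[2; l]} = {P_{12} P_{32} ⋯ P_{l2}}`. -/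
def V (F : Type*) [Field F] {n m : ℕ} (hmn : m ≤ n) : SkewRing F n m :=
  ∑ l : {l : ℕ // l ∈ Finset.Ico 2 m},
    grp F (cyc hmn l.1 (Finset.mem_Ico.1 l.2)) *
      coef F (algebraMap (PRing F n) (PLoc F n m) (brace F (tWord n l.1)))

end QuantumLie

end

noncomputable section

namespace QuantumLie

/-! ### Words -/

/-! Write N(Y) for the product of all P_{ij} with i ≠ j in Y (`fullWord`). A half word W of Y takes
one letter from each conjugate pair, so {W} = W(1 - N(Y)⁻¹). The map φ sends W to a nonzero scalar,
and N(Y) to 1 exactly when Y is conforming. The sets Y that define Σ_m use labels below m ≤ n only,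
so they omit x_n and are not conforming. In the localization all the elements 1 - N(Y) and 1 -
N(Y)⁻¹ are units.

If u is a permutation times a word and u^r = N(Y) or N(Y)⁻¹, then 1 - u divides 1 - u^r with a
commuting cofactor, so 1 - u is a unit. Every unit needed comes from this principle, with u built on
a cycle [k; l].

From here on indices start at 0 and products are those of the skew ring. Let D_k (`permSum`) be the
sum of the permutations fixing all indices below k, weighted by their inversions. Coset
representatives give D_k = C_k D_{k+1}, with C_k a weighted sum of the cycles [k; j] (`cycleSum`).
The recursion `one_sub_mul_cycleSum` makes C_k a unit, hence also D_k.

Splitting the braces gives V = C_1 P_{01} - C_1' P_{10}⁻¹, where C_1' carries the conjugate inverse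
weights (`cycleSumConj`). Counting inversions in two ways gives C_1' D_2 = D_1 z, with z the longest
weighted cycle [1; m-2]. Since D_2 commutes with P_{01} and P_{10}, V D_2 = D_1 (1 - e) P_{01} with
e = z P_{10}⁻¹ P_{01}⁻¹ (`V_mul_permSum`). The power e^{m-2} is N({0, …, m-2})⁻¹, so 1 - e is a
unit, and V is one too. -/

/-- The action of a permutation on words. -/
def act {n : ℕ} (π : Equiv.Perm (Fin n)) : Word n ≃+ Word n :=
  Finsupp.domCongr (Letter.perm π)

/-- The word with exponent `f i j` at the letter `P_{ij}`. -/
def mkWord {n : ℕ} (f : Fin n → Fin n → ℤ) : Word n :=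
  Finsupp.equivFunOnFinite.symm fun a => f a.1.1 a.1.2

@[simp] theorem mkWord_apply {n : ℕ} (f : Fin n → Fin n → ℤ) (a : Letter n) :
    mkWord f a = f a.1.1 a.1.2 := rfl

/-- The letter `P_{ij}` as a word, with `P_{ii} = 1`. -/
def letter {n : ℕ} (i j : Fin n) : Word n := mkWord fun p q => if p = i ∧ q = j then 1 else 0

theorem act_mkWord {n : ℕ} (π : Equiv.Perm (Fin n)) (f : Fin n → Fin n → ℤ) :
    act π (mkWord f) = mkWord fun p q => f (π⁻¹ p) (π⁻¹ q) := by
  ext a; rfl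

theorem act_letter {n : ℕ} (π : Equiv.Perm (Fin n)) (i j : Fin n) :
    act π (letter i j) = letter (π i) (π j) := by
  simp only [letter, act_mkWord, Equiv.Perm.inv_eq_iff_eq]

theorem act_one {n : ℕ} (A : Word n) : act (1 : Equiv.Perm (Fin n)) A = A := by
  ext a; rfl

theorem act_mul {n : ℕ} (π σ : Equiv.Perm (Fin n)) (A : Word n) :
    act (π * σ) A = act π (act σ A) := by
  ext a; rfl

theorem mkWord_add {n : ℕ} (f g : Fin n → Fin n → ℤ) :
    mkWord f + mkWord g = mkWord fun p q => f p q + g p q := by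
  ext a; rfl

theorem mkWord_congr {n : ℕ} {f g : Fin n → Fin n → ℤ} (h : ∀ p q, p ≠ q → f p q = g p q) :
    mkWord f = mkWord g := by
  ext a; exact h _ _ a.2

/-- The product of all letters `P_{ij}` with `i, j ∈ Y`. -/
def fullWord {n : ℕ} (Y : Finset (Fin n)) : Word n := ∑ i ∈ Y, ∑ j ∈ Y, letter i j

theorem fullWord_apply {n : ℕ} (Y : Finset (Fin n)) (a : Letter n) :
    fullWord Y a = if a.1.1 ∈ Y ∧ a.1.2 ∈ Y then 1 else 0 := by
  simp only [fullWord, letter, Finsupp.finsetSum_apply, mkWord_apply, ite_and]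
  by_cases h1 : a.1.1 ∈ Y <;> by_cases h2 : a.1.2 ∈ Y <;> simp [h1, h2]

theorem wordOf_apply {n : ℕ} (W : Finset (Letter n)) (a : Letter n) :
    wordOf W a = if a ∈ W then 1 else 0 := by
  simp [wordOf, Finsupp.finsetSum_apply, Finsupp.single_apply]

theorem conj_apply {n : ℕ} (A : Word n) (a : Letter n) :
    Finsupp.domCongr (Letter.conj n) A a = A ⟨(a.1.2, a.1.1), a.2.symm⟩ := rfl

theorem mono_add (F : Type*) [Field F] {n : ℕ} (A B : Word n) :
    mono F (A + B) = mono F A * mono F B := by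
  simp [mono, AddMonoidAlgebra.single_mul_single]

theorem mono_zero (F : Type*) [Field F] {n : ℕ} : mono F (0 : Word n) = 1 := rfl

/-! ### Half words -/

/-- The increasing letters with both indices in `Y`. -/
def increasingLetters {n : ℕ} (Y : Finset (Fin n)) : Finset (Letter n) :=
  Finset.univ.filter fun a => (a.1.1 ∈ Y ∧ a.1.2 ∈ Y) ∧ a.1.1 < a.1.2

theorem card_increasingLetters {n : ℕ} (Y : Finset (Fin n)) :
    (increasingLetters Y).card = Y.card.choose 2 := by
  have h1 : (increasingLetters Y).card =
      (Y.powersetCard 2).card := by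
    refine Finset.card_bij (fun a _ => {a.1.1, a.1.2}) ?_ ?_ ?_
    · intro a ha
      simp only [increasingLetters, Finset.mem_filter, Finset.mem_univ, true_and] at ha
      rw [Finset.mem_powersetCard]
      refine ⟨?_, Finset.card_pair a.2⟩
      intro x hx
      rcases Finset.mem_insert.1 hx with rfl | hx
      · exact ha.1.1
      · exact (Finset.mem_singleton.1 hx) ▸ ha.1.2
    · intro a ha b hb hab
      simp only [increasingLetters, Finset.mem_filter, Finset.mem_univ, true_and] at ha hb
      have ha1 : a.1.1 ∈ ({b.1.1, b.1.2} : Finset (Fin n)) := hab ▸ by simp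
      have ha2 : a.1.2 ∈ ({b.1.1, b.1.2} : Finset (Fin n)) := hab ▸ by simp
      simp only [Finset.mem_insert, Finset.mem_singleton] at ha1 ha2
      have := ha.2
      have := hb.2
      ext <;> grind
    · intro s hs
      obtain ⟨hs1, hs2⟩ := Finset.mem_powersetCard.1 hs
      obtain ⟨x, y, hxy, rfl⟩ := Finset.card_eq_two.1 hs2
      have hx : x ∈ Y := hs1 (by simp)
      have hy : y ∈ Y := hs1 (by simp)
      rcases lt_or_gt_of_ne hxy with h | h
      · exact ⟨⟨(x, y), hxy⟩, by simp [increasingLetters, hx, hy, h], rfl⟩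
      · exact ⟨⟨(y, x), hxy.symm⟩, by simp [increasingLetters, hx, hy, h], Finset.pair_comm _ _⟩
  rw [h1, Finset.card_powersetCard]

/-- One explicit half word for every Y, so that Σ_m contains an element attached to each admissible
Y. -/
theorem isHalfWord_increasingLetters {n : ℕ} (Y : Finset (Fin n)) :
    IsHalfWord Y (increasingLetters Y) := by
  refine ⟨fun a ha => ?_, fun a ha hc => ?_, card_increasingLetters Y⟩
  · simp only [increasingLetters, Finset.mem_filter] at ha
    exact ha.2.1
  · simp only [increasingLetters, Finset.mem_filter] at ha hc
    exact lt_asymm ha.2.2 hc.2.2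

/-- A count: W and its conjugate are disjoint and have 2·(|Y| choose 2) letters together, which is
at least the number of letters available in Y. -/
theorem IsHalfWord.union_map_conj {n : ℕ} {Y : Finset (Fin n)} {W : Finset (Letter n)}
    (h : IsHalfWord Y W) : W ∪ W.map (Letter.conj n).toEmbedding =
      Finset.univ.filter fun a : Letter n => a.1.1 ∈ Y ∧ a.1.2 ∈ Y := by
  obtain ⟨h1, h2, h3⟩ := h
  have hd : Disjoint W (W.map (Letter.conj n).toEmbedding) := by
    rw [Finset.disjoint_left]
    intro a ha hb
    obtain ⟨b, hbW, rfl⟩ := Finset.mem_map.1 hb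
    exact h2 b hbW ha
  refine Finset.eq_of_subset_of_card_le ?_ ?_
  · intro a ha
    rcases Finset.mem_union.1 ha with ha | ha
    · simpa using h1 a ha
    · obtain ⟨b, hb, rfl⟩ := Finset.mem_map.1 ha
      simpa [Letter.conj] using (h1 b hb).symm
  · rw [Finset.card_union_of_disjoint hd, Finset.card_map, h3, ← card_increasingLetters]
    have hsub : (Finset.univ.filter fun a : Letter n => a.1.1 ∈ Y ∧ a.1.2 ∈ Y) ⊆
        increasingLetters Y ∪ (increasingLetters Y).map (Letter.conj n).toEmbedding := by
      intro a ha
      simp only [Finset.mem_filter, Finset.mem_univ, true_and] at ha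
      rcases lt_or_gt_of_ne a.2 with h | h
      · exact Finset.mem_union_left _ (by simp [increasingLetters, ha, h])
      · refine Finset.mem_union_right _ (Finset.mem_map.2 ⟨⟨(a.1.2, a.1.1), a.2.symm⟩, ?_, rfl⟩)
        simp [increasingLetters, ha, h]
    refine (Finset.card_le_card hsub).trans ((Finset.card_union_le _ _).trans ?_)
    rw [Finset.card_map]

theorem IsHalfWord.wordOf_add_conj {n : ℕ} {Y : Finset (Fin n)} {W : Finset (Letter n)}
    (h : IsHalfWord Y W) :
    wordOf W + Finsupp.domCongr (Letter.conj n) (wordOf W) = fullWord Y := by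
  have hu := h.union_map_conj
  ext a
  have ha : (a ∈ W ∨ Letter.conj n a ∈ W) ↔ (a.1.1 ∈ Y ∧ a.1.2 ∈ Y) := by
    have := congrArg (fun s => a ∈ s) hu
    simp only [Finset.mem_union, Finset.mem_filter, Finset.mem_univ, true_and, eq_iff_iff] at this
    rw [← this]
    refine or_congr_right ⟨fun hc => Finset.mem_map.2 ⟨_, hc, rfl⟩, fun hc => ?_⟩
    obtain ⟨b, hb, rfl⟩ := Finset.mem_map.1 hc
    exact hb
  have hn : a ∈ W → Letter.conj n a ∉ W := h.2.1 a
  rw [Finsupp.add_apply, conj_apply, wordOf_apply, wordOf_apply, fullWord_apply]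
  change _ + (if Letter.conj n a ∈ W then (1 : ℤ) else 0) = _
  grind

/-- The inverse conjugate of W is W · N(Y)⁻¹, so up to the invertible factor W the brace depends on
Y alone. -/
theorem brace_of_isHalfWord (F : Type*) [Field F] {n : ℕ} {Y : Finset (Fin n)}
    {W : Finset (Letter n)} (h : IsHalfWord Y W) :
    brace F (wordOf W) = mono F (wordOf W) * (1 - mono F (-fullWord Y)) := by
  rw [mul_sub, mul_one, ← mono_add, brace, ← h.wordOf_add_conj]
  congr 2
  abel

/-! ### Monomial elements of the skew group ring -/

/-- A shortcut, without which the unifier does not find the ring structure of `SkewRing F n m`. -/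
instance PLoc.instCommRing (F : Type*) [Field F] (n m : ℕ) : CommRing (PLoc F n m) :=
  inferInstance

section
variable (F : Type*) [Field F] {n m : ℕ}

theorem coef_mul (a b : PLoc F n m) : coef F (a * b) = coef F a * coef F b := by
  simp only [coef, ← MulOpposite.op_mul, SkewMonoidAlgebra.single_mul_single, one_smul, mul_one,
    mul_comm]

theorem coef_one : coef F (1 : PLoc F n m) = 1 := rfl

theorem coef_sub (a b : PLoc F n m) : coef F (a - b) = coef F a - coef F b := by
  simp only [coef, ← MulOpposite.op_sub]
  congr 1
  rw [eq_sub_iff_add_eq, ← SkewMonoidAlgebra.single_add, sub_add_cancel]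

theorem isUnit_coef {a : PLoc F n m} (h : IsUnit a) : IsUnit (coef F a) := by
  obtain ⟨b, hb⟩ := isUnit_iff_exists_inv.1 h
  refine isUnit_iff_exists.2 ⟨coef F b, ?_, ?_⟩
  · rw [← coef_mul, hb, coef_one]
  · rw [← coef_mul, mul_comm, hb, coef_one]

/-- The product of a permutation and a word in the skew group ring. -/
def gmono (π : S1 n m) (A : Word n) : SkewRing F n m :=
  grp F π * coef F (algebraMap (PRing F n) (PLoc F n m) (mono F A))

/-- Moving A to the right past σ applies σ to A. The permutation part is `σ * π` because the skew
ring multiplies permutations from left to right. -/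
theorem gmono_mul (π σ : S1 n m) (A B : Word n) :
    gmono F π A * gmono F σ B = gmono F (σ * π) (act (σ : Equiv.Perm (Fin n)) A + B) := by
  rw [gmono, gmono, mul_assoc, ← mul_assoc (coef F _), coef_mul_grp, smul_algebraMap_eq,
    permAut_mono, mul_assoc, ← coef_mul, ← mul_assoc, grp_mul_grp, ← map_mul, ← mono_add]
  rfl

theorem gmono_one_eq_coef (A : Word n) : gmono F (1 : S1 n m) A =
    coef F (algebraMap (PRing F n) (PLoc F n m) (mono F A)) := by
  rw [gmono, show grp F (1 : S1 n m) = 1 from rfl, one_mul]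

theorem gmono_one_zero : gmono F (1 : S1 n m) 0 = 1 := by
  rw [gmono_one_eq_coef, mono_zero, map_one, coef_one]

theorem isUnit_gmono_one (A : Word n) : IsUnit (gmono F (1 : S1 n m) A) := by
  refine isUnit_iff_exists.2 ⟨gmono F 1 (-A), ?_, ?_⟩ <;>
  simp [gmono_mul, act_one, gmono_one_zero]

theorem gmono_pow (π : S1 n m) (A : Word n) (r : ℕ) :
    gmono F π A ^ r =
      gmono F (π ^ r) (∑ i ∈ Finset.range r, act ((π : Equiv.Perm (Fin n)) ^ i) A) := by
  induction r with
  | zero => simp [gmono_one_zero]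
  | succ r ih =>
    rw [pow_succ, ih, gmono_mul, ← pow_succ', Finset.sum_range_succ', map_sum]
    simp only [← act_mul, ← pow_succ', pow_zero, act_one]

/-! ### Units of the form `1 - u` -/

theorem isUnit_one_sub_gmono_neg_fullWord {Y : Finset (Fin n)} (hY : 2 ≤ Y.card)
    (hYm : ∀ i ∈ Y, (i : ℕ) + 1 < m) : IsUnit (1 - gmono F (1 : S1 n m) (-fullWord Y)) := by
  have h : brace F (wordOf (increasingLetters Y)) ∈ Sig F n m :=
    Submonoid.subset_closure ⟨Y, hY, hYm, _, isHalfWord_increasingLetters Y, rfl⟩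
  have h1 := IsLocalization.map_units (PLoc F n m) ⟨_, h⟩
  simp only [brace_of_isHalfWord F (isHalfWord_increasingLetters Y), map_mul] at h1
  have h2 := isUnit_coef F (isUnit_of_mul_isUnit_right h1)
  rwa [map_sub, coef_sub, map_one, coef_one, ← gmono_one_eq_coef] at h2

theorem isUnit_one_sub_gmono_fullWord {Y : Finset (Fin n)} (hY : 2 ≤ Y.card)
    (hYm : ∀ i ∈ Y, (i : ℕ) + 1 < m) : IsUnit (1 - gmono F (1 : S1 n m) (fullWord Y)) := by
  have h := IsUnit.neg ((isUnit_gmono_one F (fullWord Y)).mul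
    (isUnit_one_sub_gmono_neg_fullWord F hY hYm))
  rwa [mul_sub, mul_one, gmono_mul, OneMemClass.coe_one, act_one, add_neg_cancel, one_mul, gmono_one_zero,
    neg_sub] at h

/-- The geometric sum is a cofactor of 1 - u that commutes with it; for commuting factors, a unit
product makes both of them units even in a noncommutative ring. -/
theorem isUnit_one_sub_of_pow {R : Type*} [Ring R] {u : R} (r : ℕ) (h : IsUnit (1 - u ^ r)) :
    IsUnit (1 - u) := by
  rw [← mul_neg_geom_sum] at h
  exact ((Commute.isUnit_mul_iff (by
    rw [commute_iff_eq, mul_neg_geom_sum, geom_sum_mul_neg])).1 h).1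

theorem isUnit_one_sub_gmono {Y : Finset (Fin n)} (hY : 2 ≤ Y.card)
    (hYm : ∀ i ∈ Y, (i : ℕ) + 1 < m) {π : S1 n m} {r : ℕ} (hπ : π ^ r = 1) {A : Word n}
    (hA : (∑ i ∈ Finset.range r, act ((π : Equiv.Perm (Fin n)) ^ i) A) = fullWord Y) :
    IsUnit (1 - gmono F π A) := by
  refine isUnit_one_sub_of_pow (R := SkewRing F n m) r ?_
  rw [gmono_pow, hπ, hA]
  exact isUnit_one_sub_gmono_fullWord F hY hYm

theorem isUnit_one_sub_gmono_neg {Y : Finset (Fin n)} (hY : 2 ≤ Y.card)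
    (hYm : ∀ i ∈ Y, (i : ℕ) + 1 < m) {π : S1 n m} {r : ℕ} (hπ : π ^ r = 1) {A : Word n}
    (hA : (∑ i ∈ Finset.range r, act ((π : Equiv.Perm (Fin n)) ^ i) A) = fullWord Y) :
    IsUnit (1 - gmono F π (-A)) := by
  refine isUnit_one_sub_of_pow (R := SkewRing F n m) r ?_
  simp only [gmono_pow, hπ, map_neg, Finset.sum_neg_distrib, hA]
  exact isUnit_one_sub_gmono_neg_fullWord F hY hYm

end

/-! ### The values of `φ` on `Σ_m` -/

theorem phi_mono {G k : Type*} [CommGroup G] [Field k] {n : ℕ} (x : Fin n → QuantumVariable G k)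
    (A : Word n) : phi x (mono _ A) =
      ((∏ a : Letter n, quantParam x a.1.1 a.1.2 ^ (A a) : kˣ) : k) := by
  simp [phi, mono]

theorem phi_fullWord_ne_one {G k : Type*} [CommGroup G] [Field k] {n : ℕ}
    (x : Fin n → QuantumVariable G k) {Y : Finset (Fin n)} (hY : ¬ IsConforming x Y) :
    phi x (mono _ (-fullWord Y)) ≠ 1 := by
  rw [phi_mono]
  intro h
  refine hY ?_
  rw [← Units.val_one, Units.val_inj] at h
  simp only [Finsupp.neg_apply, zpow_neg, Finset.prod_inv_distrib, inv_eq_one,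
    fullWord_apply] at h
  rw [IsConforming, ← h]
  simp only [pow_ite, zpow_one, zpow_zero]
  rw [← Finset.prod_filter]
  refine (Finset.prod_bij (fun a _ => a.1) ?_ ?_ ?_ ?_).symm
  · intro a ha
    rw [Finset.mem_filter] at ha
    exact Finset.mem_offDiag.2 ⟨ha.2.1, ha.2.2, a.2⟩
  · intro a _ b _ hab
    exact Subtype.ext hab
  · intro b hb
    obtain ⟨h1, h2, h3⟩ := Finset.mem_offDiag.1 hb
    exact ⟨⟨b, h3⟩, by simp [h1, h2], rfl⟩
  · intro a _
    rfl

theorem phi_ne_zero {G k : Type*} [CommGroup G] [Field k] {n m : ℕ}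
    (x : Fin n → QuantumVariable G k) (hmn : m ≤ n) (hm : 3 ≤ m)
    (hx : ∀ Y : Finset (Fin n), 2 ≤ Y.card → IsConforming x Y → ∀ i : Fin n, (i : ℕ) + 1 = n → i ∈ Y)
    {f : PRing (⊥ : Subfield k) n} (hf : f ∈ Sig (⊥ : Subfield k) n m) : phi x f ≠ 0 := by
  induction hf using Submonoid.closure_induction with
  | mem f hf =>
    obtain ⟨Y, hY, hYm, W, hW, rfl⟩ := hf
    rw [brace_of_isHalfWord _ hW, map_mul, map_sub, map_one]
    refine mul_ne_zero ?_ (sub_ne_zero.2 (Ne.symm (phi_fullWord_ne_one x fun hc => ?_)))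
    · rw [phi_mono]
      exact Units.ne_zero _
    -- If Y were conforming it would contain the index n - 1, but its indices stay below m - 1.
    · have h1 := hYm _ (hx Y hY hc ⟨n - 1, by omega⟩ (by simp only; omega))
      simp only at h1
      omega
  | one => simp
  | mul f g _ _ hf hg => rw [map_mul]; exact mul_ne_zero hf hg

/-! ### Cycles -/

section
variable {n m : ℕ}

/-- The cycle `k ↦ k + 1 ↦ ⋯ ↦ l ↦ k` of (zero-based) indices, as an element of `S_{m-1}^1`. -/
def cycle (k l : ℕ) : S1 n m :=
  if h : (1 ≤ k ∧ k ≤ l) ∧ l + 1 < m ∧ l < n then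
    ⟨Fin.cycleIcc ⟨k, by omega⟩ ⟨l, h.2.2⟩, by
      rintro i (hi | hi)
      · exact Fin.cycleIcc_of_lt (Fin.lt_def.2 (by simp only; omega))
      · exact Fin.cycleIcc_of_gt (Fin.lt_def.2 (by simp only; omega))⟩
  -- With this default, `cycle k k = 1` holds for every k, in range or not.
  else 1

theorem cycle_val (hmn : m ≤ n) {k l : ℕ} (hk : 1 ≤ k) (hkl : k ≤ l) (hl : l + 1 < m) (x : Fin n) :
    (((cycle k l : S1 n m) : Equiv.Perm (Fin n)) x : ℕ) =
      if (x : ℕ) < k ∨ l < (x : ℕ) then (x : ℕ) else if (x : ℕ) = l then k else (x : ℕ) + 1 := by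
  have h : (1 ≤ k ∧ k ≤ l) ∧ l + 1 < m ∧ l < n := by omega
  have : NeZero n := ⟨by omega⟩
  rw [cycle, dif_pos h]
  simp only
  rcases lt_or_ge (x : ℕ) k with h1 | h1
  · rw [Fin.cycleIcc_of_lt (Fin.lt_def.2 h1), if_pos (Or.inl h1)]
  rcases lt_or_ge l (x : ℕ) with h2 | h2
  · rw [Fin.cycleIcc_of_gt (Fin.lt_def.2 h2), if_pos (Or.inr h2)]
  rw [if_neg (by omega)]
  rcases eq_or_lt_of_le h2 with h3 | h3
  · rw [if_pos h3]
    have : x = ⟨l, h.2.2⟩ := Fin.ext h3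
    rw [this, Fin.cycleIcc_of_last (Fin.le_def.2 hkl)]
  · rw [if_neg (by omega), Fin.cycleIcc_of_ge_of_lt (Fin.le_def.2 h1) (Fin.lt_def.2 h3),
      Fin.val_add_one_of_lt' (by omega)]

theorem cycle_inv_val (hmn : m ≤ n) {k l : ℕ} (hk : 1 ≤ k) (hkl : k ≤ l) (hl : l + 1 < m)
    (x : Fin n) :
    (((cycle k l : S1 n m) : Equiv.Perm (Fin n))⁻¹ x : ℕ) =
      if (x : ℕ) < k ∨ l < (x : ℕ) then (x : ℕ) else if (x : ℕ) = k then l else (x : ℕ) - 1 := by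
  have h := cycle_val hmn hk hkl hl (((cycle k l : S1 n m) : Equiv.Perm (Fin n))⁻¹ x)
  rw [← Equiv.Perm.mul_apply, mul_inv_cancel, Equiv.Perm.one_apply] at h
  split_ifs at h ⊢ <;> omega

theorem cycle_self (k : ℕ) : (cycle k k : S1 n m) = 1 := by
  unfold cycle
  split_ifs with h
  · have : NeZero n := ⟨by omega⟩
    exact Subtype.ext Fin.cycleIcc_eq
  · rfl

theorem cyc_eq_cycle (hmn : m ≤ n) (l : ℕ) (hl : 2 ≤ l ∧ l < m) :
    cyc hmn l hl = cycle 1 (l - 1) := by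
  rw [cycle, dif_pos (by omega)]
  rfl

/-! ### Intervals as orbits of cycles -/

/-- The indices from `k` to `l`. -/
def interval (n k l : ℕ) : Finset (Fin n) := Finset.univ.filter fun x => k ≤ (x : ℕ) ∧ (x : ℕ) ≤ l

@[simp] theorem mem_interval {k l : ℕ} {x : Fin n} :
    x ∈ interval n k l ↔ k ≤ (x : ℕ) ∧ (x : ℕ) ≤ l := by
  simp [interval]

theorem cycle_pow_val (hmn : m ≤ n) {k l : ℕ} (hk : 1 ≤ k) (hkl : k ≤ l) (hl : l + 1 < m)
    {c : Fin n} (hc : (c : ℕ) = k) (i : ℕ) (hi : k + i ≤ l) :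
    ((((cycle k l : S1 n m) : Equiv.Perm (Fin n)) ^ i) c : ℕ) = k + i := by
  induction i with
  | zero => simpa using hc
  | succ i ih =>
    have h := ih (by omega)
    rw [pow_succ', Equiv.Perm.mul_apply, cycle_val hmn hk hkl hl, h]
    split_ifs <;> omega

theorem cycle_pow_eq_one (hmn : m ≤ n) {k l : ℕ} (hk : 1 ≤ k) (hkl : k ≤ l) (hl : l + 1 < m) :
    (cycle k l : S1 n m) ^ (l + 1 - k) = 1 := by
  set c : Fin n := ⟨k, by omega⟩
  have hc : (((cycle k l : S1 n m) : Equiv.Perm (Fin n)) ^ (l + 1 - k)) c = c := by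
    apply Fin.ext
    rw [show l + 1 - k = (l - k) + 1 by omega, pow_succ', Equiv.Perm.mul_apply,
      cycle_val hmn hk hkl hl, cycle_pow_val hmn hk hkl hl rfl _ (by omega)]
    have : (c : ℕ) = k := rfl
    split_ifs <;> omega
  apply Subtype.ext
  rw [SubmonoidClass.coe_pow, OneMemClass.coe_one]
  ext x : 1
  rw [Equiv.Perm.one_apply]
  by_cases hx : x ∈ interval n k l
  · rw [mem_interval] at hx
    -- Each index of the interval is the image of k under a power of the cycle, and powers commute,
    -- so it suffices that k returns to itself.
    have : x = (((cycle k l : S1 n m) : Equiv.Perm (Fin n)) ^ ((x : ℕ) - k)) c :=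
      Fin.ext (by rw [cycle_pow_val hmn hk hkl hl rfl _ (by omega)]; omega)
    rw [this, ← Equiv.Perm.mul_apply, (Commute.pow_pow_self _ _ _).eq, Equiv.Perm.mul_apply, hc]
  · refine Equiv.Perm.pow_apply_eq_self_of_apply_eq_self ?_ _
    rw [mem_interval] at hx
    apply Fin.ext
    rw [cycle_val hmn hk hkl hl, if_pos (by omega)]

theorem cycle_pow_mem_interval (hmn : m ≤ n) {k l : ℕ} (hk : 1 ≤ k) (hkl : k ≤ l) (hl : l + 1 < m)
    (i : ℕ) {x : Fin n} (hx : x ∈ interval n k l) :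
    (((cycle k l : S1 n m) : Equiv.Perm (Fin n)) ^ i) x ∈ interval n k l := by
  induction i with
  | zero => simpa using hx
  | succ i ih =>
    rw [pow_succ', Equiv.Perm.mul_apply]
    rw [mem_interval] at ih ⊢
    rw [cycle_val hmn hk hkl hl]
    split_ifs <;> omega

theorem sum_cycle_pow_apply {M : Type*} [AddCommMonoid M] (hmn : m ≤ n) {k l : ℕ} (hk : 1 ≤ k)
    (hkl : k ≤ l) (hl : l + 1 < m) (i : ℕ) (f : Fin n → M) :
    ∑ x ∈ interval n k l, f ((((cycle k l : S1 n m) : Equiv.Perm (Fin n)) ^ i) x) =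
      ∑ x ∈ interval n k l, f x := by
  refine Finset.sum_bijective _ (Equiv.bijective
    (((cycle k l : S1 n m) : Equiv.Perm (Fin n)) ^ i)) (fun x => ?_) (fun _ _ => rfl)
  refine ⟨cycle_pow_mem_interval hmn hk hkl hl i, fun hx => ?_⟩
  have hsub : (interval n k l).map
      (((cycle k l : S1 n m) : Equiv.Perm (Fin n)) ^ i).toEmbedding = interval n k l := by
    refine Finset.eq_of_subset_of_card_le (fun y hy => ?_) (by rw [Finset.card_map])
    obtain ⟨z, hz, rfl⟩ := Finset.mem_map.1 hy
    exact cycle_pow_mem_interval hmn hk hkl hl i hz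
  rw [← hsub] at hx
  obtain ⟨z, hz, hzx⟩ := Finset.mem_map.1 hx
  exact (Equiv.injective _ hzx) ▸ hz

theorem sum_orbit_cycle {M : Type*} [AddCommMonoid M] (hmn : m ≤ n) {k l : ℕ} (hk : 1 ≤ k)
    (hkl : k ≤ l) (hl : l + 1 < m) {c : Fin n} (hc : (c : ℕ) = k) (f : Fin n → M) :
    ∑ i ∈ Finset.range (l + 1 - k), f ((((cycle k l : S1 n m) : Equiv.Perm (Fin n)) ^ i) c) =
      ∑ x ∈ interval n k l, f x := by
  refine Finset.sum_bij' (fun i _ => (((cycle k l : S1 n m) : Equiv.Perm (Fin n)) ^ i) c)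
    (fun x _ => (x : ℕ) - k) ?_ ?_ ?_ ?_ ?_
  · intro i hi
    exact cycle_pow_mem_interval hmn hk hkl hl i (mem_interval.2 (by omega))
  · intro x hx
    rw [mem_interval] at hx
    exact Finset.mem_range.2 (by omega)
  · intro i hi
    rw [Finset.mem_range] at hi
    rw [cycle_pow_val hmn hk hkl hl hc _ (by omega)]
    omega
  · intro x hx
    rw [mem_interval] at hx
    apply Fin.ext
    rw [cycle_pow_val hmn hk hkl hl hc _ (by omega)]
    omega
  · intros; rfl

/-! ### Orbit sums of words -/

/-- Powers of the cycle permute the first indices within the interval, while the second index c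
visits each point of it once. The terms P_{jj} are trivial. -/
theorem sum_act_cycle_column (hmn : m ≤ n) {k l : ℕ} (hk : 1 ≤ k) (hkl : k ≤ l) (hl : l + 1 < m)
    {c : Fin n} (hc : (c : ℕ) = k) :
    (∑ i ∈ Finset.range (l + 1 - k), act (((cycle k l : S1 n m) : Equiv.Perm (Fin n)) ^ i)
      (∑ j ∈ interval n k l, letter j c)) = fullWord (interval n k l) := by
  have h : ∀ i, act (((cycle k l : S1 n m) : Equiv.Perm (Fin n)) ^ i)
      (∑ j ∈ interval n k l, letter j c) = ∑ j ∈ interval n k l,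
        letter j ((((cycle k l : S1 n m) : Equiv.Perm (Fin n)) ^ i) c) := by
    intro i
    simp only [map_sum, act_letter]
    exact sum_cycle_pow_apply hmn hk hkl hl i fun j => letter j _
  simp only [h]
  rw [sum_orbit_cycle hmn hk hkl hl hc fun y => ∑ j ∈ interval n k l, letter j y,
    Finset.sum_comm, fullWord]

theorem sum_act_cycle_row (hmn : m ≤ n) {k l : ℕ} (hk : 1 ≤ k) (hkl : k ≤ l) (hl : l + 1 < m)
    {c : Fin n} (hc : (c : ℕ) = k) :
    (∑ i ∈ Finset.range (l + 1 - k), act (((cycle k l : S1 n m) : Equiv.Perm (Fin n)) ^ i)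
      (∑ j ∈ interval n k l, letter c j)) = fullWord (interval n k l) := by
  have h : ∀ i, act (((cycle k l : S1 n m) : Equiv.Perm (Fin n)) ^ i)
      (∑ j ∈ interval n k l, letter c j) = ∑ j ∈ interval n k l,
        letter ((((cycle k l : S1 n m) : Equiv.Perm (Fin n)) ^ i) c) j := by
    intro i
    simp only [map_sum, act_letter]
    exact sum_cycle_pow_apply hmn hk hkl hl i fun j => letter _ j
  simp only [h]
  rw [sum_orbit_cycle hmn hk hkl hl hc fun y => ∑ j ∈ interval n k l, letter y j, fullWord]

theorem letter_self (d : Fin n) : letter d d = 0 := by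
  ext a
  simp only [letter, mkWord_apply, Finsupp.coe_zero, Pi.zero_apply]
  exact if_neg fun h => a.2 (h.1.trans h.2.symm)

theorem fullWord_insert {Y : Finset (Fin n)} {d : Fin n} (hd : d ∉ Y) :
    fullWord (insert d Y) = fullWord Y + ∑ y ∈ Y, (letter d y + letter y d) := by
  simp only [fullWord, Finset.sum_insert hd, letter_self, Finset.sum_add_distrib]
  abel

theorem sum_act_cycle_pair (hmn : m ≤ n) {k l : ℕ} (hk : 1 ≤ k) (hkl : k ≤ l) (hl : l + 1 < m)
    {c d : Fin n} (hc : (c : ℕ) = k) (hd : (d : ℕ) < k) :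
    (∑ i ∈ Finset.range (l + 1 - k), act (((cycle k l : S1 n m) : Equiv.Perm (Fin n)) ^ i)
      (letter d c + letter c d)) = ∑ y ∈ interval n k l, (letter d y + letter y d) := by
  have hfix : ∀ i, (((cycle k l : S1 n m) : Equiv.Perm (Fin n)) ^ i) d = d := fun i => by
    refine Equiv.Perm.pow_apply_eq_self_of_apply_eq_self (Fin.ext ?_) _
    rw [cycle_val hmn hk hkl hl, if_pos (Or.inl hd)]
  simp only [map_add, act_letter, hfix]
  exact sum_orbit_cycle hmn hk hkl hl hc fun y => letter d y + letter y d

/-- The word `∏ P_{jk}` over `k < j ≤ l`. -/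
def column (n k l : ℕ) : Word n :=
  mkWord fun p q => if (q : ℕ) = k ∧ k < (p : ℕ) ∧ (p : ℕ) ≤ l then 1 else 0

/-- The word `∏ P_{kj}` over `k < j ≤ l`. -/
def row (n k l : ℕ) : Word n :=
  mkWord fun p q => if (p : ℕ) = k ∧ k < (q : ℕ) ∧ (q : ℕ) ≤ l then 1 else 0

theorem column_self (k : ℕ) : column n k k = 0 := by
  ext a
  simp only [column, mkWord_apply, Finsupp.coe_zero, Pi.zero_apply]
  exact if_neg (by omega)

theorem column_eq_sum {k l : ℕ} {c : Fin n} (hc : (c : ℕ) = k) :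
    column n k l = ∑ j ∈ interval n k l, letter j c := by
  subst hc
  ext a
  have ha : (a.1.1 : ℕ) ≠ a.1.2 := fun h => a.2 (Fin.ext h)
  simp only [column, letter, mkWord_apply, Finsupp.finsetSum_apply, ite_and, Finset.sum_ite_eq,
    mem_interval]
  grind

theorem row_eq_sum {k l : ℕ} {c : Fin n} (hc : (c : ℕ) = k) :
    row n k l = ∑ j ∈ interval n k l, letter c j := by
  subst hc
  ext a
  have ha : (a.1.1 : ℕ) ≠ a.1.2 := fun h => a.2 (Fin.ext h)
  simp only [row, letter, mkWord_apply, Finsupp.finsetSum_apply, ite_and]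
  by_cases h : a.1.1 = c
  · simp only [h, if_true, Finset.sum_ite_eq, mem_interval]
    grind
  · simp [h, Fin.ext_iff.not.1 h]

/-! ### Units built on cycles -/

variable (F : Type*) [Field F]

theorem two_le_card_interval {k l : ℕ} (hkl : k < l) (hl : l < n) :
    2 ≤ (interval n k l).card := by
  have hsub : ({⟨k, hkl.trans hl⟩, ⟨l, hl⟩} : Finset (Fin n)) ⊆ interval n k l := by
    intro x hx
    rcases Finset.mem_insert.1 hx with rfl | hx
    · exact mem_interval.2 ⟨le_rfl, hkl.le⟩
    · rw [Finset.mem_singleton.1 hx]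
      exact mem_interval.2 ⟨hkl.le, le_rfl⟩
  refine le_trans (Finset.card_pair ?_).ge (Finset.card_le_card hsub)
  exact fun h => hkl.ne (Fin.ext_iff.1 h)

theorem isUnit_one_sub_cycle_column (hmn : m ≤ n) {k l : ℕ} (hk : 1 ≤ k) (hkl : k < l)
    (hl : l + 1 < m) :
    IsUnit (1 - gmono F (cycle k l : S1 n m) (column n k l)) := by
  refine isUnit_one_sub_gmono F (two_le_card_interval hkl (by omega)) (fun i hi => ?_)
    (cycle_pow_eq_one hmn hk hkl.le hl) ?_
  · rw [mem_interval] at hi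
    omega
  · rw [column_eq_sum (c := ⟨k, by omega⟩) rfl]
    exact sum_act_cycle_column hmn hk hkl.le hl rfl

theorem two_le_card_insert_interval {k l : ℕ} (hkl : k ≤ l) (hl : l < n) {d : Fin n}
    (hd : (d : ℕ) < k) : 2 ≤ (insert d (interval n k l)).card := by
  rw [Finset.card_insert_of_notMem (by rw [mem_interval]; omega)]
  exact Nat.succ_le_succ (Finset.card_pos.2 ⟨⟨l, hl⟩, mem_interval.2 ⟨hkl, le_rfl⟩⟩)

/-- The fixed index d joins the orbit: the extra pair contributes all letters between d and the
interval. Hence k = l is allowed here. -/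
theorem isUnit_one_sub_cycle_column_pair (hmn : m ≤ n) {k l : ℕ} (hk : 1 ≤ k) (hkl : k ≤ l)
    (hl : l + 1 < m) {c d : Fin n} (hc : (c : ℕ) = k) (hd : (d : ℕ) < k) :
    IsUnit (1 - gmono F (cycle k l : S1 n m) (column n k l + (letter d c + letter c d))) := by
  refine isUnit_one_sub_gmono F (two_le_card_insert_interval hkl (by omega) hd) (fun i hi => ?_)
    (cycle_pow_eq_one hmn hk hkl hl) ?_
  · rw [Finset.mem_insert, mem_interval] at hi
    rcases hi with rfl | hi <;> omega
  · simp only [map_add _ (column n k l), Finset.sum_add_distrib]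
    rw [column_eq_sum hc, sum_act_cycle_column hmn hk hkl hl hc,
      sum_act_cycle_pair hmn hk hkl hl hc hd, fullWord_insert (by rw [mem_interval]; omega)]

theorem isUnit_one_sub_cycle_row_pair (hmn : m ≤ n) {k l : ℕ} (hk : 1 ≤ k) (hkl : k ≤ l)
    (hl : l + 1 < m) {c d : Fin n} (hc : (c : ℕ) = k) (hd : (d : ℕ) < k) :
    IsUnit (1 - gmono F (cycle k l : S1 n m) (-(row n k l + (letter d c + letter c d)))) := by
  refine isUnit_one_sub_gmono_neg F (two_le_card_insert_interval hkl (by omega) hd)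
    (fun i hi => ?_) (cycle_pow_eq_one hmn hk hkl hl) ?_
  · rw [Finset.mem_insert, mem_interval] at hi
    rcases hi with rfl | hi <;> omega
  · simp only [map_add _ (row n k l), Finset.sum_add_distrib]
    rw [row_eq_sum hc, sum_act_cycle_row hmn hk hkl hl hc,
      sum_act_cycle_pair hmn hk hkl hl hc hd, fullWord_insert (by rw [mem_interval]; omega)]

end

section
variable (F : Type*) [Field F] {n m : ℕ}

/-! ### Sums over cycles -/

/-- The sum of the cycles `[k; j]`, `k ≤ j < b`, weighted by their inversions. -/
def cycleSum (k b : ℕ) : SkewRing F n m :=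
  ∑ j ∈ Finset.Ico k b, gmono F (cycle k j) (column n k j)

/-- The sum of the cycles `[k; j]`, `k ≤ j < b`, weighted by their conjugate inversions. -/
def cycleSumConj (k b : ℕ) : SkewRing F n m :=
  ∑ j ∈ Finset.Ico k b, gmono F (cycle k j) (-row n k j)

theorem cycle_mul_cycle (hmn : m ≤ n) {k l t : ℕ} (hk : 1 ≤ k) (hkl : k ≤ l) (hlt : l < t)
    (ht : t + 1 < m) :
    (cycle k (l + 1) * cycle k t : S1 n m) = cycle (k + 1) t * cycle k l := by
  apply Subtype.ext
  ext x
  simp only [Subgroup.coe_mul, Equiv.Perm.mul_apply]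
  rw [cycle_val hmn hk (by omega) (by omega), cycle_val hmn hk (by omega) ht,
    cycle_val hmn (by omega) (by omega) ht, cycle_val hmn hk hkl (by omega)]
  split_ifs <;> omega

/-- On the left, [k; l+1] carries the column of k to the column of k+1 together with P_{k,k+1}. On
the right, [k+1; t] shifts the column of k up by one and so misses P_{k+1,k}. The added pair
supplies exactly these two letters. -/
theorem cycle_column_mul (hmn : m ≤ n) {k l t : ℕ} (hk : 1 ≤ k) (hkl : k ≤ l) (hlt : l < t)
    (ht : t + 1 < m) {c d : Fin n} (hc : (c : ℕ) = k + 1) (hd : (d : ℕ) = k) :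
    gmono F (cycle k t : S1 n m) (column n k t) * gmono F (cycle k (l + 1)) (column n k (l + 1)) =
      gmono F (cycle k l) (column n k l) *
        gmono F (cycle (k + 1) t) (column n (k + 1) t + (letter d c + letter c d)) := by
  rw [gmono_mul, gmono_mul, cycle_mul_cycle hmn hk hkl hlt ht]
  congr 1
  simp only [column, letter, act_mkWord, mkWord_add]
  refine mkWord_congr fun p q hpq => ?_
  rw [cycle_inv_val hmn hk (by omega) (by omega), cycle_inv_val hmn hk (by omega) (by omega),
    cycle_inv_val hmn (by omega) (by omega) ht, cycle_inv_val hmn (by omega) (by omega) ht]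
  simp only [Fin.ext_iff, hc, hd]
  have hpq' : (p : ℕ) ≠ q := fun h => hpq (Fin.ext h)
  generalize (p : ℕ) = p at *
  generalize (q : ℕ) = q at *
  grind

theorem one_sub_mul_eq_mul_one_sub {R ι : Type*} [Ring R] {s : Finset ι} {f g : ι → R}
    {y z a : R} (h1 : a = ∑ i ∈ s, f i + z) (h2 : a = 1 + ∑ i ∈ s, g i)
    (h : ∀ i ∈ s, z * g i = f i * y) : (1 - z) * a = (∑ i ∈ s, f i) * (1 - y) := by
  have h3 : z * a = z + (∑ i ∈ s, f i) * y := by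
    rw [h2, mul_add, mul_one, Finset.mul_sum, Finset.sum_mul, Finset.sum_congr rfl h]
  rw [sub_mul, one_mul, h3, h1, mul_sub, mul_one]
  abel

/-- Left multiplication by the last summand turns the terms [k; j+1] into the terms [k; j] times one
fixed element, so nearly everything cancels. This passes invertibility from t to t + 1. -/
theorem one_sub_mul_cycleSum (hmn : m ≤ n) {k t : ℕ} (hk : 1 ≤ k) (hkt : k < t)
    (ht : t + 1 < m) {c d : Fin n} (hc : (c : ℕ) = k + 1) (hd : (d : ℕ) = k) :
    (1 - gmono F (cycle k t : S1 n m) (column n k t)) * cycleSum F k (t + 1) =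
      cycleSum F k t *
        (1 - gmono F (cycle (k + 1) t) (column n (k + 1) t + (letter d c + letter c d))) := by
  have h1 : (cycleSum F k (t + 1) : SkewRing F n m) =
      cycleSum F k t + gmono F (cycle k t) (column n k t) :=
    Finset.sum_Ico_succ_top hkt.le _
  have h2 : (cycleSum F k (t + 1) : SkewRing F n m) =
      1 + ∑ j ∈ Finset.Ico k t, gmono F (cycle k (j + 1)) (column n k (j + 1)) := by
    rw [cycleSum, Finset.sum_eq_sum_Ico_succ_bot (by omega), cycle_self, column_self, gmono_one_zero,
      Finset.sum_Ico_add' (fun j => gmono F (cycle k j : S1 n m) (column n k j)) k t 1]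
  refine one_sub_mul_eq_mul_one_sub (R := SkewRing F n m) h1 h2 fun j hj => ?_
  rw [Finset.mem_Ico] at hj
  exact cycle_column_mul F hmn hk hj.1 hj.2 ht hc hd

theorem isUnit_cycleSum (hmn : m ≤ n) {k t : ℕ} (hk : 1 ≤ k) (hkt : k ≤ t) (ht : t + 1 < m) :
    IsUnit (cycleSum F k (t + 1) : SkewRing F n m) := by
  induction t, hkt using Nat.le_induction with
  | base =>
    rw [cycleSum, Nat.Ico_succ_singleton, Finset.sum_singleton, cycle_self, column_self, gmono_one_zero]
    exact isUnit_one
  | succ t hkt ih =>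
    have h := one_sub_mul_cycleSum F hmn hk (Nat.lt_succ_of_le hkt) ht
      (c := ⟨k + 1, by omega⟩) (d := ⟨k, by omega⟩) rfl rfl
    have h1 := isUnit_one_sub_cycle_column F hmn hk (Nat.lt_succ_of_le hkt) ht
    have h2 := isUnit_one_sub_cycle_column_pair F hmn (k := k + 1) (by omega)
      (Nat.succ_le_succ hkt) ht (c := ⟨k + 1, by omega⟩) (d := ⟨k, by omega⟩) rfl (Nat.lt_succ_self k)
    have h3 := (ih (by omega)).mul h2
    rw [← h] at h3
    obtain ⟨u, hu⟩ := h1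
    rw [← hu] at h3
    exact (Units.isUnit_units_mul u _).1 h3

/-! ### Sums over permutations -/

/-- The permutations in `S_{m-1}^1` that fix all indices below `k`. -/
def fixing (n m k : ℕ) : Finset (S1 n m) :=
  (Set.toFinite {w : S1 n m | ∀ i : Fin n, (i : ℕ) < k →
    (w : Equiv.Perm (Fin n)) i = i}).toFinset

theorem mem_fixing {k : ℕ} {w : S1 n m} : w ∈ fixing n m k ↔
    ∀ i : Fin n, (i : ℕ) < k → (w : Equiv.Perm (Fin n)) i = i := by
  simp [fixing]

theorem inv_apply_eq_self {k : ℕ} {w : S1 n m} (hw : w ∈ fixing n m k) {i : Fin n}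
    (hi : (i : ℕ) < k ∨ m ≤ (i : ℕ) + 1) : (w : Equiv.Perm (Fin n))⁻¹ i = i := by
  rw [Equiv.Perm.inv_eq_iff_eq]
  rcases hi with hi | hi
  · exact (mem_fixing.1 hw i hi).symm
  · exact (w.2 i (Or.inr hi)).symm

theorem inv_apply_mem {k : ℕ} {w : S1 n m} (hw : w ∈ fixing n m k) {i : Fin n}
    (hi : k ≤ (i : ℕ) ∧ (i : ℕ) + 1 < m) :
    k ≤ ((w : Equiv.Perm (Fin n))⁻¹ i : ℕ) ∧ ((w : Equiv.Perm (Fin n))⁻¹ i : ℕ) + 1 < m := by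
  by_contra hc
  have h := inv_apply_eq_self hw (i := (w : Equiv.Perm (Fin n))⁻¹ i) (by omega)
  rw [(Equiv.injective _ h)] at hc
  exact hc hi

/-- Coset decomposition: l is the index that the permutation sends to k, and removing `cycle k l`
leaves a permutation that fixes k as well. -/
theorem sum_fixing {M : Type*} [AddCommMonoid M] (hmn : m ≤ n) {k : ℕ} (hk : 1 ≤ k)
    (hkm : k + 1 < m) (f : S1 n m → M) :
    ∑ w ∈ fixing n m k, f w =
      ∑ l ∈ Finset.Ico k (m - 1), ∑ w ∈ fixing n m (k + 1), f (w * cycle k l) := by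
  rw [← Finset.sum_product']
  set c : Fin n := ⟨k, by omega⟩ with hc
  have hck : (c : ℕ) = k := rfl
  symm
  refine Finset.sum_bij' (fun x _ => x.2 * cycle k x.1)
    (fun w _ => (((w : Equiv.Perm (Fin n))⁻¹ c : ℕ),
      w * (cycle k ((w : Equiv.Perm (Fin n))⁻¹ c : ℕ))⁻¹)) ?_ ?_ ?_ ?_ ?_
  · rintro ⟨l, w⟩ hx
    simp only [Finset.mem_product, Finset.mem_Ico] at hx
    refine mem_fixing.2 fun i hi => ?_
    rw [Subgroup.coe_mul, Equiv.Perm.mul_apply]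
    have h1 : ((cycle k l : S1 n m) : Equiv.Perm (Fin n)) i = i :=
      Fin.ext (by rw [cycle_val hmn hk (by omega) (by omega), if_pos (Or.inl hi)])
    rw [h1]
    exact mem_fixing.1 hx.2 i (by omega)
  · intro w hw
    have hl := inv_apply_mem hw (i := c) (by omega)
    refine Finset.mem_product.2 ⟨Finset.mem_Ico.2 ⟨hl.1, by simp only; omega⟩,
      mem_fixing.2 fun i hi => ?_⟩
    simp only [Subgroup.coe_mul, Equiv.Perm.mul_apply, Subgroup.coe_inv]
    rcases Nat.lt_succ_iff_lt_or_eq.1 hi with h | h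
    · have h1 : ((cycle k ((w : Equiv.Perm (Fin n))⁻¹ c : ℕ) : S1 n m) : Equiv.Perm (Fin n))⁻¹ i = i :=
        Fin.ext (by rw [cycle_inv_val hmn hk hl.1 hl.2, if_pos (Or.inl h)])
      rw [h1]
      exact mem_fixing.1 hw i h
    · have h1 : ((cycle k ((w : Equiv.Perm (Fin n))⁻¹ c : ℕ) : S1 n m) : Equiv.Perm (Fin n))⁻¹ i =
          (w : Equiv.Perm (Fin n))⁻¹ c :=
        Fin.ext (by rw [cycle_inv_val hmn hk hl.1 hl.2, if_neg (by omega), if_pos h])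
      rw [h1, ← Equiv.Perm.mul_apply, mul_inv_cancel, Equiv.Perm.one_apply]
      exact Fin.ext h.symm
  · rintro ⟨l, w⟩ hx
    simp only [Finset.mem_product, Finset.mem_Ico] at hx
    have h1 : ((((w * cycle k l : S1 n m) : Equiv.Perm (Fin n))⁻¹ c : Fin n) : ℕ) = l := by
      rw [Subgroup.coe_mul, mul_inv_rev, Equiv.Perm.mul_apply,
        inv_apply_eq_self hx.2 (i := c) (by omega),
        cycle_inv_val hmn hk hx.1.1 (by omega), if_neg (by omega), if_pos hck]
    simp only [h1, mul_inv_cancel_right]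
  · intro w hw
    simp
  · intros; rfl

/-! ### Inversions -/

/-- The product of all `P_{ba}`, where `a < b` is an inversion of `w⁻¹`. -/
def inversionWord (w : S1 n m) : Word n :=
  mkWord fun p q => if q < p ∧ (w : Equiv.Perm (Fin n))⁻¹ p < (w : Equiv.Perm (Fin n))⁻¹ q
    then 1 else 0

/-- The variant of `inversionWord` in which the inversions `k < b` contribute `P_{kb}⁻¹`. -/
def mixedInversionWord (k : ℕ) (w : S1 n m) : Word n :=
  mkWord fun p q =>
    (if (q : ℕ) ≠ k ∧ q < p ∧ (w : Equiv.Perm (Fin n))⁻¹ p < (w : Equiv.Perm (Fin n))⁻¹ q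
      then 1 else 0) -
    (if (p : ℕ) = k ∧ p < q ∧ (w : Equiv.Perm (Fin n))⁻¹ q < (w : Equiv.Perm (Fin n))⁻¹ p
      then 1 else 0)

/-- The column is the inversion word of the cycle. The inverse cycle preserves the order of the
indices above k, so inversions away from k are those of w; those at k are the column moved by w. -/
theorem cycle_column_mul_perm (hmn : m ≤ n) {k l : ℕ} (hk : 1 ≤ k) (hkl : k ≤ l) (hl : l + 1 < m)
    {w : S1 n m} (hw : w ∈ fixing n m (k + 1)) :
    gmono F (cycle k l) (column n k l) * gmono F w (inversionWord w) =
      gmono F (w * cycle k l) (inversionWord (w * cycle k l)) := by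
  rw [gmono_mul]
  congr 1
  simp only [column, inversionWord, act_mkWord, mkWord_add]
  refine mkWord_congr fun p q hpq => ?_
  have hpq' : (p : ℕ) ≠ q := fun h => hpq (Fin.ext h)
  have hxy : ((w : Equiv.Perm (Fin n))⁻¹ p : ℕ) ≠ (w : Equiv.Perm (Fin n))⁻¹ q :=
    fun h => hpq (Equiv.injective _ (Fin.ext h))
  have hp1 := inv_apply_eq_self hw (i := p)
  have hp2 := inv_apply_mem hw (i := p)
  have hq1 := inv_apply_eq_self hw (i := q)
  have hq2 := inv_apply_mem hw (i := q)
  have hu := cycle_inv_val hmn hk hkl hl ((w : Equiv.Perm (Fin n))⁻¹ p)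
  have hv := cycle_inv_val hmn hk hkl hl ((w : Equiv.Perm (Fin n))⁻¹ q)
  simp only [Subgroup.coe_mul, mul_inv_rev, Equiv.Perm.mul_apply, Fin.lt_def]
  simp only [Fin.ext_iff] at hp1 hq1
  generalize (((cycle k l : S1 n m) : Equiv.Perm (Fin n))⁻¹ ((w : Equiv.Perm (Fin n))⁻¹ p) : ℕ) =
    u at *
  generalize (((cycle k l : S1 n m) : Equiv.Perm (Fin n))⁻¹ ((w : Equiv.Perm (Fin n))⁻¹ q) : ℕ) =
    v at *
  generalize (((w : Equiv.Perm (Fin n))⁻¹ p : Fin n) : ℕ) = x at *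
  generalize (((w : Equiv.Perm (Fin n))⁻¹ q : Fin n) : ℕ) = y at *
  generalize (p : ℕ) = p at *
  generalize (q : ℕ) = q at *
  -- Only the order of the indices and of their preimages matters now, so this is a finite case
  -- check in linear arithmetic.
  split_ifs at hu hv ⊢ <;> omega

theorem cycle_row_mul_perm (hmn : m ≤ n) {k l : ℕ} (hk : 1 ≤ k) (hkl : k ≤ l) (hl : l + 1 < m)
    {w : S1 n m} (hw : w ∈ fixing n m (k + 1)) :
    gmono F (cycle k l) (-row n k l) * gmono F w (inversionWord w) =
      gmono F (w * cycle k l) (mixedInversionWord k (w * cycle k l)) := by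
  rw [gmono_mul, map_neg, neg_add_eq_sub]
  congr 1
  rw [sub_eq_iff_eq_add]
  simp only [row, inversionWord, mixedInversionWord, act_mkWord, mkWord_add]
  refine mkWord_congr fun p q hpq => ?_
  have hpq' : (p : ℕ) ≠ q := fun h => hpq (Fin.ext h)
  have hxy : ((w : Equiv.Perm (Fin n))⁻¹ p : ℕ) ≠ (w : Equiv.Perm (Fin n))⁻¹ q :=
    fun h => hpq (Equiv.injective _ (Fin.ext h))
  have hp1 := inv_apply_eq_self hw (i := p)
  have hp2 := inv_apply_mem hw (i := p)
  have hq1 := inv_apply_eq_self hw (i := q)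
  have hq2 := inv_apply_mem hw (i := q)
  have hu := cycle_inv_val hmn hk hkl hl ((w : Equiv.Perm (Fin n))⁻¹ p)
  have hv := cycle_inv_val hmn hk hkl hl ((w : Equiv.Perm (Fin n))⁻¹ q)
  simp only [Subgroup.coe_mul, mul_inv_rev, Equiv.Perm.mul_apply, Fin.lt_def]
  simp only [Fin.ext_iff] at hp1 hq1
  generalize (((cycle k l : S1 n m) : Equiv.Perm (Fin n))⁻¹ ((w : Equiv.Perm (Fin n))⁻¹ p) : ℕ) =
    u at *
  generalize (((cycle k l : S1 n m) : Equiv.Perm (Fin n))⁻¹ ((w : Equiv.Perm (Fin n))⁻¹ q) : ℕ) =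
    v at *
  generalize (((w : Equiv.Perm (Fin n))⁻¹ p : Fin n) : ℕ) = x at *
  generalize (((w : Equiv.Perm (Fin n))⁻¹ q : Fin n) : ℕ) = y at *
  generalize (p : ℕ) = p at *
  generalize (q : ℕ) = q at *
  split_ifs at hu hv ⊢ <;> omega

/-- The cycle sends the last movable index t = m - 2 to k and shifts the others up in order.
Inversions of w⁻¹ involving t become letters P_{kb}; dividing by the whole row leaves P_{kb}⁻¹ for
the complementary b, which are the inversions at k of the new permutation. This needs t to be last.
-/
theorem perm_mul_cycle_row (hmn : m ≤ n) {k t : ℕ} (hk : 1 ≤ k) (hkt : k ≤ t) (ht : t + 2 = m)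
    {w : S1 n m} (hw : w ∈ fixing n m k) :
    gmono F w (inversionWord w) * gmono F (cycle k t) (-row n k t) =
      gmono F (cycle k t * w) (mixedInversionWord k (cycle k t * w)) := by
  rw [gmono_mul, ← sub_eq_add_neg]
  congr 1
  rw [sub_eq_iff_eq_add]
  simp only [row, inversionWord, mixedInversionWord, act_mkWord, mkWord_add]
  refine mkWord_congr fun p q hpq => ?_
  have hpq' : (p : ℕ) ≠ q := fun h => hpq (Fin.ext h)
  simp only [Subgroup.coe_mul, mul_inv_rev, Equiv.Perm.mul_apply, Fin.lt_def]
  have hx := cycle_inv_val hmn hk hkt (by omega : t + 1 < m) p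
  have hy := cycle_inv_val hmn hk hkt (by omega : t + 1 < m) q
  generalize (((cycle k t : S1 n m) : Equiv.Perm (Fin n))⁻¹ p) = x at *
  generalize (((cycle k t : S1 n m) : Equiv.Perm (Fin n))⁻¹ q) = y at *
  have huv : ((w : Equiv.Perm (Fin n))⁻¹ x : ℕ) = (w : Equiv.Perm (Fin n))⁻¹ y → (x : ℕ) = y :=
    fun h => Fin.ext_iff.1 (Equiv.injective _ (Fin.ext h))
  have hp1 := inv_apply_eq_self hw (i := x)
  have hp2 := inv_apply_mem hw (i := x)
  have hq1 := inv_apply_eq_self hw (i := y)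
  have hq2 := inv_apply_mem hw (i := y)
  simp only [Fin.ext_iff] at hp1 hq1
  generalize (((w : Equiv.Perm (Fin n))⁻¹ x : Fin n) : ℕ) = u at *
  generalize (((w : Equiv.Perm (Fin n))⁻¹ y : Fin n) : ℕ) = v at *
  generalize (x : ℕ) = x at *
  generalize (y : ℕ) = y at *
  generalize (p : ℕ) = p at *
  generalize (q : ℕ) = q at *
  split_ifs at hx hy ⊢ <;> omega

/-- The sum of the permutations that fix all indices below `k`, weighted by their inversions. -/
def permSum (k : ℕ) : SkewRing F n m :=
  ∑ w ∈ fixing n m k, gmono F w (inversionWord w)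

theorem permSum_eq_mul (hmn : m ≤ n) {k : ℕ} (hk : 1 ≤ k) (hkm : k + 1 < m) :
    (permSum F k : SkewRing F n m) = cycleSum F k (m - 1) * permSum F (k + 1) := by
  rw [permSum, sum_fixing hmn hk hkm, cycleSum, Finset.sum_mul]
  refine Finset.sum_congr rfl fun l hl => ?_
  rw [Finset.mem_Ico] at hl
  rw [permSum, Finset.mul_sum]
  exact Finset.sum_congr rfl fun w hw =>
    (cycle_column_mul_perm F hmn hk hl.1 (by omega) hw).symm

theorem cycleSumConj_mul_permSum (hmn : m ≤ n) {k t : ℕ} (hk : 1 ≤ k) (hkt : k ≤ t)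
    (ht : t + 2 = m) :
    (cycleSumConj F k (m - 1) * permSum F (k + 1) : SkewRing F n m) =
      permSum F k * gmono F (cycle k t) (-row n k t) := by
  -- Both sides equal the sum over `fixing n m k` with mixed weights: the left by cosets, the right
  -- by the bijection of left multiplication with the longest cycle.
  have h1 : (cycleSumConj F k (m - 1) * permSum F (k + 1) : SkewRing F n m) =
      ∑ w ∈ fixing n m k, gmono F w (mixedInversionWord k w) := by
    rw [sum_fixing hmn hk (by omega), cycleSumConj, Finset.sum_mul]
    refine Finset.sum_congr rfl fun l hl => ?_
    rw [Finset.mem_Ico] at hl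
    rw [permSum, Finset.mul_sum]
    exact Finset.sum_congr rfl fun w hw => cycle_row_mul_perm F hmn hk hl.1 (by omega) hw
  have hz : (cycle k t : S1 n m) ∈ fixing n m k := mem_fixing.2 fun i hi =>
    Fin.ext (by rw [cycle_val hmn hk hkt (by omega), if_pos (Or.inl hi)])
  rw [h1, permSum, Finset.sum_mul]
  symm
  refine Finset.sum_bijective (cycle k t * ·) (Group.mulLeft_bijective _) (fun w => ?_)
    fun w hw => perm_mul_cycle_row F hmn hk hkt ht hw
  simp only [mem_fixing, Subgroup.coe_mul, Equiv.Perm.mul_apply]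
  rw [mem_fixing] at hz
  refine forall₂_congr fun i hi => ⟨fun h => by rw [h, hz i hi], fun h => ?_⟩
  exact Equiv.injective _ (h.trans (hz i hi).symm)

theorem permSum_last (hm : 1 ≤ m) : (permSum F (m - 1) : SkewRing F n m) = 1 := by
  have h : fixing n m (m - 1) = {1} := by
    ext w
    rw [mem_fixing, Finset.mem_singleton]
    refine ⟨fun h => Subtype.ext (Equiv.ext fun i => ?_), fun h => by simp [h]⟩
    rcases lt_or_ge (i : ℕ) (m - 1) with hi | hi
    · exact h i hi
    · exact w.2 i (Or.inr (by omega))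
  have h0 : inversionWord (1 : S1 n m) = 0 := by
    ext a
    simp only [inversionWord, mkWord_apply, OneMemClass.coe_one, inv_one, Equiv.Perm.one_apply]
    exact if_neg fun h => lt_asymm h.1 h.2
  rw [permSum, h, Finset.sum_singleton, h0, gmono_one_zero]

theorem isUnit_permSum (hmn : m ≤ n) {k : ℕ} (hk : 1 ≤ k) (hkm : k ≤ m - 1) :
    IsUnit (permSum F k : SkewRing F n m) := by
  induction hkm using Nat.decreasingInduction with
  | self => rw [permSum_last F (by omega)]; exact isUnit_one
  | of_succ k hkm ih =>
    rw [permSum_eq_mul F hmn hk (by omega)]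
    have h := isUnit_cycleSum F hmn hk (t := m - 2) (by omega) (by omega)
    rw [show m - 2 + 1 = m - 1 by omega] at h
    exact h.mul (ih (by omega))

/-! ### The invertibility of `V_(m)` -/

theorem tWord_eq {l : ℕ} (hl : 1 ≤ l) {c d : Fin n} (hc : (c : ℕ) = 1) (hd : (d : ℕ) = 0) :
    tWord n (l + 1) = column n 1 l + letter d c := by
  ext a
  have ha : (a.1.1 : ℕ) ≠ a.1.2 := fun h => a.2 (Fin.ext h)
  simp only [tWord, wordOf_apply, Finset.mem_filter, Finset.mem_univ, true_and, column, letter,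
    Finsupp.add_apply, mkWord_apply, Fin.ext_iff, hc, hd]
  grind

theorem conj_tWord_eq {l : ℕ} (hl : 1 ≤ l) {c d : Fin n} (hc : (c : ℕ) = 1) (hd : (d : ℕ) = 0) :
    Finsupp.domCongr (Letter.conj n) (tWord n (l + 1)) = row n 1 l + letter c d := by
  rw [tWord_eq hl hc hd]
  ext a
  simp only [conj_apply, column, row, letter, Finsupp.add_apply, mkWord_apply]
  grind

theorem V_eq (hmn : m ≤ n) {c d : Fin n} (hc : (c : ℕ) = 1) (hd : (d : ℕ) = 0) :
    V F hmn = cycleSum F 1 (m - 1) * gmono F 1 (letter d c) -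
      cycleSumConj F 1 (m - 1) * gmono F 1 (-letter c d) := by
  -- Defined for all natural numbers, so that the sum over a subtype becomes a sum over an interval
  -- of labels, which is then shifted to indices.
  let f : ℕ → SkewRing F n m := fun l => gmono F (cycle 1 (l - 1)) (tWord n l) -
    gmono F (cycle 1 (l - 1)) (-Finsupp.domCongr (Letter.conj n) (tWord n l))
  have h : V F hmn = ∑ l ∈ Finset.Ico 2 m, f l := by
    refine Eq.trans (Finset.sum_congr rfl fun l _ => ?_) (Finset.sum_coe_sort (Finset.Ico 2 m) f)
    rw [cyc_eq_cycle, brace, map_sub, coef_sub, mul_sub]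
    rfl
  rw [h, cycleSum, cycleSumConj, Finset.sum_mul, Finset.sum_mul, ← Finset.sum_sub_distrib]
  rcases Nat.lt_or_ge m 2 with hm | hm
  · rw [Finset.Ico_eq_empty (by omega), Finset.Ico_eq_empty (by omega)]
    simp
  obtain ⟨t, rfl⟩ : ∃ t, m = t + 1 := ⟨m - 1, by omega⟩
  rw [← Finset.sum_Ico_add' _ 1 t 1, Nat.add_sub_cancel]
  refine Finset.sum_congr rfl fun l hl => ?_
  rw [Finset.mem_Ico] at hl
  simp only [f]
  rw [Nat.add_sub_cancel, conj_tWord_eq hl.1 hc hd, tWord_eq hl.1 hc hd, gmono_mul, gmono_mul,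
    OneMemClass.coe_one, act_one, act_one, one_mul, neg_add]

theorem gmono_one_mul_permSum {A : Word n} {k : ℕ}
    (hA : ∀ w ∈ fixing n m k, act (w : Equiv.Perm (Fin n)) A = A) :
    gmono F (1 : S1 n m) A * permSum F k = permSum F k * gmono F 1 A := by
  rw [permSum, Finset.mul_sum, Finset.sum_mul]
  refine Finset.sum_congr rfl fun w hw => ?_
  rw [gmono_mul, gmono_mul, hA w hw, OneMemClass.coe_one, act_one, mul_one, one_mul, add_comm]

theorem sub_mul_eq_mul_one_sub_mul {R : Type*} [Ring R] {a b c d e s u z : R}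
    (ha : a * s = s * a) (hb : b * s = s * b) (hc : c * s = u) (hd : d * s = u * z)
    (he : z * b = e * a) : (c * a - d * b) * s = u * ((1 - e) * a) := by
  rw [sub_mul, mul_assoc, ha, ← mul_assoc, hc, mul_assoc, hb, ← mul_assoc, hd, mul_assoc, he,
    ← mul_sub, sub_mul, one_mul]

/-- The permutations in `permSum F 2` fix the indices 0 and 1, so the words P_{01} and P_{10}⁻¹ pass
through it. Both halves of V then acquire the common left factor `permSum F 1`. -/
theorem V_mul_permSum (hmn : m ≤ n) {t : ℕ} (ht1 : 1 ≤ t) (ht : t + 2 = m) {c d : Fin n}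
    (hc : (c : ℕ) = 1) (hd : (d : ℕ) = 0) :
    V F hmn * permSum F 2 = permSum F 1 *
      ((1 - gmono F (cycle 1 t) (-(row n 1 t + (letter d c + letter c d)))) *
        gmono F 1 (letter d c)) := by
  have hfix : ∀ w ∈ fixing n m 2, (w : Equiv.Perm (Fin n)) c = c ∧ (w : Equiv.Perm (Fin n)) d = d :=
    fun w hw => ⟨mem_fixing.1 hw c (by omega), mem_fixing.1 hw d (by omega)⟩
  rw [V_eq F hmn hc hd]
  refine sub_mul_eq_mul_one_sub_mul (R := SkewRing F n m)
    (gmono_one_mul_permSum F fun w hw => ?_) (gmono_one_mul_permSum F fun w hw => ?_)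
    (permSum_eq_mul F hmn le_rfl (by omega)).symm (cycleSumConj_mul_permSum F hmn le_rfl ht1 ht) ?_
  · rw [act_letter, (hfix w hw).1, (hfix w hw).2]
  · rw [map_neg, act_letter, (hfix w hw).1, (hfix w hw).2]
  · rw [gmono_mul, gmono_mul, OneMemClass.coe_one, act_one, act_one]
    congr 1
    abel

theorem isUnit_V (hmn : m ≤ n) (hm : 3 ≤ m) : IsUnit (V F hmn) := by
  have h := V_mul_permSum F hmn (t := m - 2) (by omega) (by omega)
    (c := ⟨1, by omega⟩) (d := ⟨0, by omega⟩) rfl rfl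
  have h1 := isUnit_one_sub_cycle_row_pair F hmn (k := 1) (l := m - 2) le_rfl (by omega) (by omega)
    (c := ⟨1, by omega⟩) (d := ⟨0, by omega⟩) rfl Nat.zero_lt_one
  have h2 := (isUnit_permSum F hmn (k := 1) le_rfl (by omega)).mul
    (h1.mul (isUnit_gmono_one F (letter ⟨0, by omega⟩ ⟨1, by omega⟩)))
  rw [← h] at h2
  obtain ⟨u, hu⟩ := isUnit_permSum F hmn (k := 2) (by omega) (by omega)
  rw [← hu] at h2
  exact (Units.isUnit_mul_units _ u).1 h2

end

end QuantumLie

end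

theorem lemma5p1 {G k : Type*} [CommGroup G] [Field k] (n : ℕ)
    (x : Fin n → QuantumLie.QuantumVariable G k)
    (hx : ∀ Y : Finset (Fin n), 2 ≤ Y.card → QuantumLie.IsConforming x Y →
      ∀ i : Fin n, (i : ℕ) + 1 = n → i ∈ Y)
    (m : ℕ) (hm : 3 ≤ m) (hmn : m ≤ n) :
    (∀ f ∈ QuantumLie.Sig (⊥ : Subfield k) n m, QuantumLie.phi x f ≠ 0) ∧
      IsUnit (QuantumLie.V (⊥ : Subfield k) hmn) :=
  ⟨fun _ hf => QuantumLie.phi_ne_zero x hmn hm hx hf, QuantumLie.isUnit_V _ hmn hm⟩
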